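/- Let $1<q<2$ and $0<r<\frac1q-\frac12$, and put $$u:=\frac1r-q\Bigl(1+\frac1{2r}\Bigr),$$ which is $>0$. There is a constant $C_{q,r}>0$ depending only on $q$ and $r$ such that the following holds. Let $\mathbb H$ be a real separable Hilbert space with an (infinite, ordered) orthonormal basis $\mathcal D=\{\phi_j\}_{j\ge 1}$, let $\varepsilon>0$, and let $R>0$ be such that $R\varepsilon^{-1}\ge\max(e^2,u^2)$. For an unknown $f\in\mathbb H$ one observes the process $$Y(h)=\langle f,h\rangle+\varepsilon W(h),\qquad h\in\mathbb H,$$ where $W$ is an isonormal process, i.e. a centered Gaussian process with $\mathbb E[W(g)W(h)]=\langle g,h\rangle$ for all $g,h\in\mathbb H$. Then $$\inf_{\tilde f}\ \sup_{f\in\mathcal B_{q,r}(R)}\mathbb E\bigl[\|f-\tilde f\|^2\bigr]\ \ge\ C_{q,r}\,R^q\Bigl(\varepsilon\sqrt{\ln(R\varepsilon^{-1})}\Bigr)^{2-q},$$ where the infimum is taken over all estimators $\tilde f$, that is, all $\mathbb H$-valued measurable functions of the observed process $Y$. Here $\mathcal B_{q,r}(R)$ is defined as follows. For $p\ge1$ and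 $h$ in the linear span $\mathcal L_1(\mathcal D_p)$ of $\mathcal D_p=\{\phi_1,\dots,\phi_p\}$, let $\|h\|_{\mathcal L_1(\mathcal D_p)}=\inf\{\sum_{j\le p}|\theta_j| : \theta\in\mathbb R^p,\ h=\sum_{j\le p}\theta_j\phi_j\}$. The space $\mathcal L_{1,r}$ consists of all $g\in\mathbb H$ for which there is $C>0$ such that for every $p\ge1$ there is $g_p\in\mathcal L_1(\mathcal D_p)$ with $\|g_p\|_{\mathcal L_1(\mathcal D_p)}\le C$ and $\|g-g_p\|\le Cp^{-r}$; the infimum of such $C$ is $\|g\|_{\mathcal L_{1,r}}$. Finally, $g\in\mathcal B_{q,r}(R)$ if, for all $\delta>0$, $$\inf_{h\in\mathcal L_{1,r}}\bigl(\|g-h\|+\delta\|h\|_{\mathcal L_{1,r}}\bigr)\le R\,\delta^{2/q-1}.$$ -/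

import Mathlib

open MeasureTheory ProbabilityTheory
open scoped ENNReal

noncomputable section

/-- The space `L₁(D_p)`: the linear span of the truncated dictionary `D_p = {φ₁, …, φ_p}`.
The dictionary `(φ_j)_{j ≥ 1}` is indexed from `0` here, so that `φ_j` is `φ (j - 1)`. -/
def truncSpan {H : Type*} [NormedAddCommGroup H] [InnerProductSpace ℝ H]
    (φ : ℕ → H) (p : ℕ) : Submodule ℝ H :=
  Submodule.span ℝ (Set.range fun j : Fin p => φ j)

/-- The norm of `L₁(D_p)`: the infimum of `∑_{j ≤ p} |θ_j|` over all `θ ∈ ℝ^p` such that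
`h = ∑_{j ≤ p} θ_j φ_j`. It is meant for `h` in the span of `D_p`, where the infimum is over a
nonempty set. -/
def truncNorm {H : Type*} [NormedAddCommGroup H] [InnerProductSpace ℝ H]
    (φ : ℕ → H) (p : ℕ) (h : H) : ℝ :=
  sInf {c : ℝ | ∃ θ : Fin p → ℝ, h = ∑ j : Fin p, θ j • φ j ∧ c = ∑ j : Fin p, |θ j|}

/-- `C` is an admissible constant for `g` in the definition of the space `L_{1,r}`: `C > 0` and,
for all `p ≥ 1`, some `g_p` in the span of `D_p` satisfies `‖g_p‖_{L₁(D_p)} ≤ C` and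
`‖g - g_p‖ ≤ C p^{-r}`. -/
def IsL1rBound {H : Type*} [NormedAddCommGroup H] [InnerProductSpace ℝ H]
    (φ : ℕ → H) (r : ℝ) (g : H) (C : ℝ) : Prop :=
  0 < C ∧ ∀ p : ℕ, 1 ≤ p → ∃ gp ∈ truncSpan φ p,
    truncNorm φ p gp ≤ C ∧ ‖g - gp‖ ≤ C * (p : ℝ) ^ (-r)

/-- The space `L_{1,r}`. -/
def L1r {H : Type*} [NormedAddCommGroup H] [InnerProductSpace ℝ H]
    (φ : ℕ → H) (r : ℝ) : Set H :=
  {g | ∃ C : ℝ, IsL1rBound φ r g C}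

/-- The norm of `L_{1,r}`: the infimum of the admissible constants. -/
def l1rNorm {H : Type*} [NormedAddCommGroup H] [InnerProductSpace ℝ H]
    (φ : ℕ → H) (r : ℝ) (g : H) : ℝ :=
  sInf {C : ℝ | IsL1rBound φ r g C}

/-- The ball `B_{q,r}(R)`: all `g` such that, for all `δ > 0`,
`inf_{h ∈ L_{1,r}} (‖g - h‖ + δ ‖h‖_{L_{1,r}}) ≤ R δ^{2α}`, where `α = 1/q - 1/2`. -/
def bqr {H : Type*} [NormedAddCommGroup H] [InnerProductSpace ℝ H]
    (φ : ℕ → H) (q r R : ℝ) : Set H :=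
  {g | ∀ δ : ℝ, 0 < δ →
    ⨅ h : L1r φ r, (‖g - (h : H)‖ + δ * l1rNorm φ r (h : H)) ≤ R * δ ^ (2 * (1 / q - 1 / 2))}

/-- `W` is an isonormal process on `H`: a centered Gaussian process with
`E[W(g) W(h)] = ⟨g, h⟩` for all `g, h`. -/
structure IsIsonormal {H Ω : Type*} [NormedAddCommGroup H] [InnerProductSpace ℝ H]
    [MeasurableSpace Ω] (W : H → Ω → ℝ) (P : Measure Ω) : Prop where
  measurable : ∀ h, Measurable (W h)
  gaussian : IsGaussianProcess W P
  centered : ∀ h, ∫ ω, W h ω ∂P = 0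
  covariance : ∀ g h, ∫ ω, W g ω * W h ω ∂P = inner ℝ g h

/-- The observed process `Y(h) = ⟨f, h⟩ + ε W(h)`, `h ∈ H`. -/
def observation {H Ω : Type*} [NormedAddCommGroup H] [InnerProductSpace ℝ H]
    (W : H → Ω → ℝ) (ε : ℝ) (f : H) (ω : Ω) : H → ℝ :=
  fun h => inner ℝ f h + ε * W h ω

/-- The quadratic risk `E ‖f - T(Y)‖²`, in `[0, ∞]`, at the target `f`, of the estimator that maps
the observed process `Y` to `T Y`. -/
def quadRisk {H Ω : Type*} [NormedAddCommGroup H] [InnerProductSpace ℝ H] [MeasurableSpace Ω]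
    (W : H → Ω → ℝ) (P : Measure Ω) (ε : ℝ) (T : (H → ℝ) → H) (f : H) : ℝ≥0∞ :=
  ∫⁻ ω, ‖f - T (observation W ε f ω)‖ₑ ^ 2 ∂P

/-- The minimax risk over `A ⊆ H`: the infimum over all estimators, i.e. all measurable maps `T`
from the observed processes (with the product `σ`-algebra) to `H`, of the supremum over `f ∈ A`
of the quadratic risk. -/
def minimaxRisk {H Ω : Type*} [NormedAddCommGroup H] [InnerProductSpace ℝ H] [MeasurableSpace H]
    [MeasurableSpace Ω] (W : H → Ω → ℝ) (P : Measure Ω) (ε : ℝ) (A : Set H) : ℝ≥0∞ :=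
  ⨅ (T : (H → ℝ) → H) (_ : Measurable T), ⨆ f ∈ A, quadRisk W P ε T f

end

/-! The risk is bounded below by a Bayes risk. The prior cuts the first `m * B` basis vectors into
`m` blocks of length `B` and puts one spike of height `η`, at a uniform independent position, in
each block.

Within a block, Cameron–Martin (`IsIsonormal.lintegral_shift`) turns the law under each spike into a
density with second moment `exp ((η/ε)²)` against pure noise. When this is at most `B / 4`, the
position cannot be located, and the block costs at least `η² / 8` on average
(`IsIsonormal.le_sum_lintegral_spikeLoss`). By Bessel's inequality the blocks add up to `m η² / 8`.

A spike vector has `ℓ¹` norm `m η` and Hilbert norm `√m η`. Interpolating between the two puts it in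
the ball once `m ^ (1/q) η ≤ R`, provided `(m B) ^ r ≤ √m`, which lets the smoothness constraint
hold (`sum_smul_mem_bqr`). This allows `B` to be a power of `m`, hence at least a power of `R/ε`, so
that `η` can be a small multiple of `ε √(log (R/ε))`. With `m` of order `(R/η) ^ q`, the bound `m
η²` has order `R ^ q η ^ (2 - q)`. -/

/-! ### Gaussian shifts -/

/-- The change of variables `z ↦ z + c` under the standard Gaussian law. -/
lemma lintegral_gaussianReal_add_const (c : ℝ) {F : ℝ → ℝ≥0∞} (hF : Measurable F) :
    ∫⁻ z, F (z + c) ∂(gaussianReal 0 1) =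
      ∫⁻ z, F z * ENNReal.ofReal (Real.exp (c * z - c ^ 2 / 2)) ∂(gaussianReal 0 1) := by
  rw [← lintegral_map (g := fun z => z + c) hF (by fun_prop), gaussianReal_map_add_const,
    gaussianReal_of_var_ne_zero _ one_ne_zero, gaussianReal_of_var_ne_zero _ one_ne_zero,
    lintegral_withDensity_eq_lintegral_mul _ (by fun_prop) hF,
    lintegral_withDensity_eq_lintegral_mul _ (by fun_prop) (by fun_prop)]
  refine lintegral_congr fun z => ?_
  simp only [Pi.mul_apply, gaussianPDF_def, gaussianPDFReal_def]
  rw [mul_comm (F z), ← mul_assoc, ← ENNReal.ofReal_mul (by positivity), mul_assoc _ (Real.exp _),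
    ← Real.exp_add]
  congr 5
  simp
  ring

namespace IsIsonormal

variable {H Ω : Type*} [NormedAddCommGroup H] [InnerProductSpace ℝ H] [MeasurableSpace Ω]
  {W : H → Ω → ℝ} {P : Measure Ω}

lemma memLp_two (hW : IsIsonormal W P) (h : H) : MemLp (W h) 2 P :=
  (hW.gaussian.hasGaussianLaw_eval h).memLp_two

lemma map_eq_gaussianReal (hW : IsIsonormal W P) {e : H} (he : ‖e‖ = 1) :
    P.map (W e) = gaussianReal 0 1 := by
  have hg := hW.gaussian.hasGaussianLaw_eval e
  have hp := hW.gaussian.isProbabilityMeasure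
  have hv : Var[W e; P] = 1 := by
    rw [variance_of_integral_eq_zero (hW.measurable e).aemeasurable (hW.centered e)]
    have := hW.covariance e e
    rw [real_inner_self_eq_norm_sq, he] at this
    simpa [pow_two] using this
  rw [hg.map_eq_gaussianReal, hW.centered, hv]
  simp

/-- The part of an isonormal process that is orthogonal to the direction `e` is independent of its
value at `e`. -/
lemma indepFun_orthogonal (hW : IsIsonormal W P) {e : H} (he : ‖e‖ = 1) :
    IndepFun (fun ω h => W h ω - inner ℝ e h * W e ω) (W e) P := by
  classical
  have hp := hW.gaussian.isProbabilityMeasure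
  have hm := hW.measurable
  -- Both parts are linear in `W`, hence jointly Gaussian, and zero covariance is enough.
  have hG : IsGaussianProcess
      (Sum.elim (fun h ω => W h ω - inner ℝ e h * W e ω) (fun (_ : Unit) ω => W e ω)) P := by
    refine hW.gaussian.of_isGaussianProcess fun s => ?_
    rcases s with h | _
    · refine ⟨{h, e}, ContinuousLinearMap.proj ⟨h, by simp⟩ -
        inner ℝ e h • ContinuousLinearMap.proj ⟨e, by simp⟩, fun ω => ?_⟩
      simp
    · exact ⟨{e}, ContinuousLinearMap.proj ⟨e, by simp⟩, fun ω => by simp⟩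
  have hI := hG.indepFun_of_covariance_eq_zero (fun h => by fun_prop) (fun _ => by fun_prop)
    (fun h _ => ?_)
  · exact hI.comp measurable_id (measurable_pi_apply ())
  · have h1 := hW.memLp_two h
    have h2 := hW.memLp_two e
    have hc : ∀ g k : H, cov[W g, W k; P] = inner ℝ g k := fun g k => by
      rw [covariance_eq_sub (hW.memLp_two g) (hW.memLp_two k), hW.centered, zero_mul, sub_zero]
      exact hW.covariance g k
    have h3 : MemLp (fun ω => inner ℝ e h * W e ω) 2 P := h2.const_mul _
    have := covariance_sub_left h1 h3 h2
    refine this.trans ?_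
    rw [covariance_const_mul_left, hc, hc, real_inner_self_eq_norm_sq, he, real_inner_comm]
    ring

/-- Cameron–Martin formula for an isonormal process, in the direction of a unit vector. -/
theorem lintegral_shift (hW : IsIsonormal W P) {e : H} (he : ‖e‖ = 1) (c : ℝ)
    {F : (H → ℝ) → ℝ≥0∞} (hF : Measurable F) :
    ∫⁻ ω, F (fun h => W h ω + c * inner ℝ e h) ∂P =
      ∫⁻ ω, F (fun h => W h ω) * ENNReal.ofReal (Real.exp (c * W e ω - c ^ 2 / 2)) ∂P := by
  have hp := hW.gaussian.isProbabilityMeasure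
  have hm := hW.measurable
  -- Since `‖e‖ = 1`, shifting `W` along `e` leaves `V` fixed and only translates `W e`.
  -- Independence then reduces the formula to the real line.
  set V : Ω → H → ℝ := fun ω h => W h ω - inner ℝ e h * W e ω with hV
  have hVm : Measurable V := measurable_pi_lambda _ fun h => by fun_prop
  have hmap : P.map (fun ω => (V ω, W e ω)) = (P.map V).prod (gaussianReal 0 1) := by
    rw [(indepFun_iff_map_prod_eq_prod_map_map hVm.aemeasurable (hm e).aemeasurable).1
      (hW.indepFun_orthogonal he), hW.map_eq_gaussianReal he]
  have hpm : Measurable fun ω => (V ω, W e ω) := hVm.prodMk (hm e)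
  let K : (H → ℝ) × ℝ → H → ℝ := fun x h => x.1 h + inner ℝ e h * x.2
  have hK : Measurable K := measurable_pi_lambda _ fun h => by fun_prop
  have key : ∀ G : (H → ℝ) × ℝ → ℝ≥0∞, Measurable G → ∫⁻ ω, G (V ω, W e ω) ∂P =
      ∫⁻ v, ∫⁻ z, G (v, z) ∂(gaussianReal 0 1) ∂(P.map V) := fun G hG => by
    rw [← lintegral_map hG hpm, hmap, lintegral_prod _ hG.aemeasurable]
  have h1 := key (fun x => F (K (x.1, x.2 + c))) (by fun_prop)
  have h2 := key (fun x => F (K x) * ENNReal.ofReal (Real.exp (c * x.2 - c ^ 2 / 2)))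
    (by fun_prop)
  have e1 : ∀ ω, (fun h => W h ω + c * inner ℝ e h) = K (V ω, W e ω + c) := fun ω => by
    ext h; simp only [K, hV]; ring
  have e2 : ∀ ω, (fun h => W h ω) = K (V ω, W e ω) := fun ω => by
    ext h; simp only [K, hV]; ring
  simp_rw [e1]
  rw [h1]
  refine Eq.trans ?_ (h2.symm.trans ?_)
  · refine lintegral_congr fun v => ?_
    exact lintegral_gaussianReal_add_const c (F := fun z => F (K (v, z))) (by fun_prop)
  · exact lintegral_congr fun ω => by rw [e2 ω]

lemma lintegral_exp (hW : IsIsonormal W P) {e : H} (he : ‖e‖ = 1) (c : ℝ) :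
    ∫⁻ ω, ENNReal.ofReal (Real.exp (c * W e ω - c ^ 2 / 2)) ∂P = 1 := by
  have hp := hW.gaussian.isProbabilityMeasure
  simpa using (hW.lintegral_shift he c (F := fun _ => 1) measurable_const).symm

/-- The squared density at `c` is `exp (c²)` times the density at `2c`, which has mass one. -/
lemma lintegral_exp_sq (hW : IsIsonormal W P) {e : H} (he : ‖e‖ = 1) (c : ℝ) :
    ∫⁻ ω, ENNReal.ofReal (Real.exp (c * W e ω - c ^ 2 / 2) ^ 2) ∂P =
      ENNReal.ofReal (Real.exp (c ^ 2)) := by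
  have hm := hW.measurable e
  have : ∀ ω, ENNReal.ofReal (Real.exp (c * W e ω - c ^ 2 / 2) ^ 2) =
      ENNReal.ofReal (Real.exp (c ^ 2)) *
        ENNReal.ofReal (Real.exp (2 * c * W e ω - (2 * c) ^ 2 / 2)) := fun ω => by
    rw [← ENNReal.ofReal_mul (by positivity), ← Real.exp_add, ← Real.exp_nat_mul]
    congr 2
    push_cast
    ring
  simp_rw [this]
  rw [lintegral_const_mul _ (by fun_prop), hW.lintegral_exp he, mul_one]

end IsIsonormal

/-! ### Locating a single spike -/

/-- The squared Euclidean distance from `t` to the vector `η e_b`. -/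
def spikeLoss {κ : Type*} [Fintype κ] [DecidableEq κ] (η : ℝ) (b : κ) (t : κ → ℝ) : ℝ :=
  ∑ k, ((if k = b then η else 0) - t k) ^ 2

lemma spikeLoss_nonneg {κ : Type*} [Fintype κ] [DecidableEq κ] (η : ℝ) (b : κ) (t : κ → ℝ) :
    0 ≤ spikeLoss η b t := Finset.sum_nonneg fun _ _ => sq_nonneg _

lemma measurable_spikeLoss {κ : Type*} [Fintype κ] [DecidableEq κ] (η : ℝ) (b : κ) :
    Measurable (spikeLoss η b) := by
  unfold spikeLoss
  fun_prop

/-- A point is at distance less than `η / 2` from at most one of the vectors `η e_b`. -/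
lemma le_spikeLoss_of_ne {κ : Type*} [Fintype κ] [DecidableEq κ] {η : ℝ} (hη : 0 < η) {b c : κ}
    (hbc : c ≠ b) {t : κ → ℝ} (hb : spikeLoss η b t < η ^ 2 / 4) :
    η ^ 2 / 4 ≤ spikeLoss η c t := by
  have h1 : (η - t b) ^ 2 ≤ spikeLoss η b t := by
    simpa [spikeLoss] using Finset.single_le_sum (f := fun k => ((if k = b then η else 0) - t k) ^ 2)
      (fun _ _ => sq_nonneg _) (Finset.mem_univ b)
  have h2 : t b ^ 2 ≤ spikeLoss η c t := by
    simpa [spikeLoss, hbc.symm] using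
      Finset.single_le_sum (f := fun k => ((if k = c then η else 0) - t k) ^ 2)
      (fun _ _ => sq_nonneg _) (Finset.mem_univ b)
  have h3 : η / 2 < t b := by nlinarith
  nlinarith

/-- At most one index `b` has loss below `η² / 4`, so only its weight `w b` is lost. The AM-GM bound
`w b ≤ a/2 + w b² / (2a)`, with the square enlarged to the sum of all squares, trades this maximum
for second moments. -/
lemma sum_le_sum_mul_spikeLoss {κ : Type*} [Fintype κ] [DecidableEq κ] {η a : ℝ} (hη : 0 < η)
    (ha : 0 < a) (t : κ → ℝ) {w : κ → ℝ} (hw : ∀ b, 0 ≤ w b) :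
    η ^ 2 / 4 * ∑ b, w b ≤
      ∑ b, w b * spikeLoss η b t + η ^ 2 / 4 * (a / 2 + ∑ b, w b ^ 2 / (2 * a)) := by
  have hs : 0 ≤ ∑ b, w b ^ 2 / (2 * a) := Finset.sum_nonneg fun b _ => by positivity
  by_cases h : ∃ b, spikeLoss η b t < η ^ 2 / 4
  · obtain ⟨b, hb⟩ := h
    have h1 : w b ≤ a / 2 + w b ^ 2 / (2 * a) := by
      rw [div_add_div _ _ two_ne_zero (by positivity), le_div_iff₀ (by positivity)]
      nlinarith [sq_nonneg (w b - a)]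
    have h2 : w b ^ 2 / (2 * a) ≤ ∑ b, w b ^ 2 / (2 * a) :=
      Finset.single_le_sum (f := fun b => w b ^ 2 / (2 * a)) (fun b _ => by positivity)
        (Finset.mem_univ b)
    have h3 : ∑ c, η ^ 2 / 4 * (w c - if c = b then w b else 0) ≤
        ∑ c, w c * spikeLoss η c t := by
      refine Finset.sum_le_sum fun c _ => ?_
      split_ifs with hc
      · subst hc
        simpa using mul_nonneg (hw c) (spikeLoss_nonneg η c t)
      · nlinarith [mul_le_mul_of_nonneg_left (le_spikeLoss_of_ne hη hc hb) (hw c)]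
    rw [← Finset.mul_sum, Finset.sum_sub_distrib, Finset.sum_ite_eq' Finset.univ b] at h3
    simp only [Finset.mem_univ, if_true] at h3
    nlinarith [sq_nonneg η]
  · push Not at h
    have h3 : ∑ c, η ^ 2 / 4 * w c ≤ ∑ c, w c * spikeLoss η c t :=
      Finset.sum_le_sum fun c _ => by nlinarith [mul_le_mul_of_nonneg_left (h c) (hw c)]
    rw [← Finset.mul_sum] at h3
    have : 0 ≤ η ^ 2 / 4 * (a / 2 + ∑ b, w b ^ 2 / (2 * a)) := by positivity
    linarith

/-- Bayes risk for the problem of locating one spike of height `η` among `κ` orthonormal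
directions, from an isonormal observation at noise level `ε`. -/
theorem IsIsonormal.le_sum_lintegral_spikeLoss {H Ω κ : Type*} [NormedAddCommGroup H]
    [InnerProductSpace ℝ H] [MeasurableSpace Ω] {W : H → Ω → ℝ} {P : Measure Ω}
    (hW : IsIsonormal W P) [Fintype κ] [DecidableEq κ] {e : κ → H} (he : ∀ b, ‖e b‖ = 1)
    {T : (H → ℝ) → κ → ℝ} (hT : Measurable T) (g : H) {ε η : ℝ} (hε : 0 < ε) (hη : 0 < η)
    (hcard : Real.exp ((η / ε) ^ 2) ≤ Fintype.card κ / 4) :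
    ENNReal.ofReal (Fintype.card κ * (η ^ 2 / 8)) ≤
      ∑ b, (∫⁻ ω, ENNReal.ofReal
        (spikeLoss η b (T (observation W ε (g + η • e b) ω))) ∂P) := by
  have hp := hW.gaussian.isProbabilityMeasure
  have hm := hW.measurable
  set n : ℝ := (Fintype.card κ : ℝ) with hn
  have hn0 : 0 < n := by have := Real.exp_pos ((η / ε) ^ 2); linarith
  let S : (H → ℝ) → κ → ℝ := fun y => T fun h => inner ℝ g h + ε * y h
  have hS : Measurable S := hT.comp (measurable_pi_lambda _ fun h => by fun_prop)
  let w : κ → Ω → ℝ := fun b ω => Real.exp (η / ε * W (e b) ω - (η / ε) ^ 2 / 2)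
  have hwm : ∀ b, Measurable (w b) := fun b => by
    have := hm (e b)
    fun_prop
  have hWm : Measurable fun ω (h : H) => W h ω := measurable_pi_lambda _ hm
  have hL : ∀ b, Measurable (spikeLoss (κ := κ) η b) := measurable_spikeLoss η
  have hshift : ∀ b, ∫⁻ ω, ENNReal.ofReal
      (spikeLoss η b (T (observation W ε (g + η • e b) ω))) ∂P =
      ∫⁻ ω, ENNReal.ofReal (w b ω * spikeLoss η b (S fun h => W h ω)) ∂P := fun b => by
    have := hW.lintegral_shift (he b) (η / ε)
      (F := fun y => ENNReal.ofReal (spikeLoss η b (S y))) (((hL b).comp hS).ennreal_ofReal)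
    calc _ = ∫⁻ ω, ENNReal.ofReal
            (spikeLoss η b (S fun h => W h ω + η / ε * inner ℝ (e b) h)) ∂P := by
          refine lintegral_congr fun ω => ?_
          congr 3
          ext h
          simp only [observation, inner_add_left, real_inner_smul_left]
          field_simp
          ring
      _ = _ := this
      _ = _ := lintegral_congr fun ω => by
          rw [mul_comm (w b ω), ENNReal.ofReal_mul (spikeLoss_nonneg _ _ _)]
  have hRm : ∀ b, Measurable fun ω =>
      ENNReal.ofReal (w b ω * spikeLoss η b (S fun h => W h ω)) := fun b =>
    ((hwm b).mul ((hL b).comp (hS.comp hWm))).ennreal_ofReal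
  simp_rw [hshift]
  rw [← lintegral_finsetSum _ fun b _ => hRm b]
  set R : ℝ≥0∞ := ∫⁻ ω, ∑ b, ENNReal.ofReal (w b ω * spikeLoss η b (S fun h => W h ω)) ∂P
  -- With `a = n / 2` the correction has mean `η²/4 * (n/4 + exp ((η/ε)²))`, at most `n η² / 8` by
  -- `hcard`: half of the main term.
  have hmain : ENNReal.ofReal (η ^ 2 / 4 * n) ≤ R + ENNReal.ofReal (n * (η ^ 2 / 8)) := by
    have h1 : ENNReal.ofReal (η ^ 2 / 4 * n) =
        ∫⁻ ω, ENNReal.ofReal (η ^ 2 / 4 * ∑ b, w b ω) ∂P := by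
      have : ∀ ω, ENNReal.ofReal (η ^ 2 / 4 * ∑ b, w b ω) =
          ENNReal.ofReal (η ^ 2 / 4) * ∑ b, ENNReal.ofReal (w b ω) := fun ω => by
        rw [ENNReal.ofReal_mul (by positivity),
          ENNReal.ofReal_sum_of_nonneg fun b _ => (Real.exp_pos _).le]
      simp_rw [this]
      rw [lintegral_const_mul _ (by fun_prop), lintegral_finsetSum _ fun b _ => by fun_prop]
      simp only [w, hW.lintegral_exp (he _)]
      rw [ENNReal.ofReal_mul (by positivity)]
      simp [hn]
    have h2 : ∫⁻ ω, ENNReal.ofReal (η ^ 2 / 4 * (n / 2 / 2 + ∑ b, w b ω ^ 2 / (2 * (n / 2)))) ∂P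
        ≤ ENNReal.ofReal (n * (η ^ 2 / 8)) := by
      have : ∀ ω, ENNReal.ofReal (η ^ 2 / 4 * (n / 2 / 2 + ∑ b, w b ω ^ 2 / (2 * (n / 2)))) =
          ENNReal.ofReal (η ^ 2 / 4) * (ENNReal.ofReal (n / 4) +
            ENNReal.ofReal (1 / n) * ∑ b, ENNReal.ofReal (w b ω ^ 2)) := fun ω => by
        rw [← ENNReal.ofReal_sum_of_nonneg fun b _ => sq_nonneg _,
          ← ENNReal.ofReal_mul (by positivity), ← ENNReal.ofReal_add (by positivity)
            (mul_nonneg (by positivity) (Finset.sum_nonneg fun b _ => sq_nonneg _)),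
          ← ENNReal.ofReal_mul (by positivity), Finset.mul_sum]
        congr 3
        · ring
        · refine Finset.sum_congr rfl fun b _ => ?_
          field_simp
      simp_rw [this]
      rw [lintegral_const_mul _ (by fun_prop), lintegral_add_left (by fun_prop),
        lintegral_const_mul _ (by fun_prop), lintegral_finsetSum _ fun b _ => by fun_prop]
      simp only [w, hW.lintegral_exp_sq (he _)]
      simp only [lintegral_const, measure_univ, mul_one, Finset.sum_const, Finset.card_univ,
        nsmul_eq_mul]
      rw [← ENNReal.ofReal_natCast (Fintype.card κ), ← ENNReal.ofReal_mul (by positivity),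
        ← ENNReal.ofReal_mul (by positivity), ← ENNReal.ofReal_add (by positivity) (by positivity),
        ← ENNReal.ofReal_mul (by positivity)]
      refine ENNReal.ofReal_le_ofReal ?_
      rw [← hn, ← mul_assoc, one_div, inv_mul_cancel₀ hn0.ne', one_mul]
      nlinarith [sq_nonneg η]
    rw [h1]
    refine le_trans (lintegral_mono fun ω => ?_)
      ((lintegral_add_left (Finset.measurable_fun_sum _ fun b _ => hRm b) _).le.trans
          (add_le_add_right h2 _))
    have hpw : ∀ b, 0 ≤ w b ω := fun b => (Real.exp_pos _).le
    refine (ENNReal.ofReal_le_ofReal (sum_le_sum_mul_spikeLoss hη (half_pos hn0)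
      (S fun h => W h ω) hpw)).trans (ENNReal.ofReal_add_le.trans (le_of_eq ?_))
    rw [ENNReal.ofReal_sum_of_nonneg fun b _ => mul_nonneg (hpw b) (spikeLoss_nonneg _ _ _)]
  rw [show η ^ 2 / 4 * n = n * (η ^ 2 / 8) + n * (η ^ 2 / 8) by ring,
    ENNReal.ofReal_add (by positivity) (by positivity)] at hmain
  exact (ENNReal.add_le_add_iff_right ENNReal.ofReal_ne_top).1 hmain

/-! ### Product prior over blocks -/

/-- The vector with one spike of height `η` per block `i`, at position `σ i` of the block. -/
def spikes {H ι κ : Type*} [NormedAddCommGroup H] [InnerProductSpace ℝ H] [Fintype ι]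
    (e : ι × κ → H) (η : ℝ) (σ : ι → κ) : H :=
  ∑ i, η • e (i, σ i)

section Blocks

variable {H ι κ : Type*} [NormedAddCommGroup H] [InnerProductSpace ℝ H] [Fintype ι]
  [DecidableEq ι] {e : ι × κ → H}

lemma inner_spikes [DecidableEq κ] (he : Orthonormal ℝ e) (η : ℝ) (σ : ι → κ) (i : ι) (k : κ) :
    inner ℝ (e (i, k)) (spikes e η σ) = if k = σ i then η else 0 := by
  simp only [spikes, inner_sum, real_inner_smul_right, orthonormal_iff_ite.1 he, Prod.mk.injEq]
  rw [Finset.sum_eq_single i]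
  · simp
  · intro j _ hj
    simp [hj.symm]
  · simp

/-- Bessel's inequality for the family `e`: losses in different blocks add up. -/
lemma sum_spikeLoss_le [Fintype κ] [DecidableEq κ] (he : Orthonormal ℝ e) (η : ℝ) (σ : ι → κ)
    (h : H) :
    ∑ i, spikeLoss η (σ i) (fun k => inner ℝ (e (i, k)) h) ≤ ‖spikes e η σ - h‖ ^ 2 := by
  have := he.sum_inner_products_le (x := spikes e η σ - h) (s := Finset.univ)
  rw [Fintype.sum_prod_type] at this
  refine le_trans (le_of_eq ?_) this
  simp only [spikeLoss, inner_sub_right, inner_spikes he, Real.norm_eq_abs, sq_abs]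

lemma spikes_update (e : ι × κ → H) (η : ℝ) (σ : ι → κ) (i : ι) (b : κ) :
    spikes e η (Function.update σ i b) =
      ∑ j ∈ Finset.univ.erase i, η • e (j, σ j) + η • e (i, b) := by
  rw [spikes, ← Finset.sum_erase_add _ _ (Finset.mem_univ i)]
  congr 1
  · refine Finset.sum_congr rfl fun j hj => ?_
    rw [Function.update_of_ne (Finset.ne_of_mem_erase hj)]
  · simp

/-- Resampling one coordinate does not change a sum over all functions. -/
lemma sum_sum_update [Fintype κ] (i : ι) (G : (ι → κ) → ℝ≥0∞) :
    ∑ σ : ι → κ, ∑ b, G (Function.update σ i b) = Fintype.card κ * ∑ σ, G σ := by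
  have h : ∑ x : (ι → κ) × κ, G (Function.update x.1 i x.2) = ∑ x : (ι → κ) × κ, G x.1 := by
    refine Finset.sum_bij' (fun x _ => (Function.update x.1 i x.2, x.1 i))
      (fun x _ => (Function.update x.1 i x.2, x.1 i)) ?_ ?_ ?_ ?_ ?_ <;> simp
  rw [Fintype.sum_prod_type, Fintype.sum_prod_type] at h
  rw [h]
  simp [Finset.mul_sum]

variable {Ω : Type*} [MeasurableSpace Ω] {W : H → Ω → ℝ} {P : Measure Ω}

/-- Lower bound for the minimax risk over a set that contains all vectors with one spike per
block. -/
theorem IsIsonormal.le_minimaxRisk_of_spikes [MeasurableSpace H] [BorelSpace H]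
    (hW : IsIsonormal W P) [Fintype κ] (he : Orthonormal ℝ e) {ε η : ℝ} (hε : 0 < ε) (hη : 0 < η)
    (hcard : Real.exp ((η / ε) ^ 2) ≤ Fintype.card κ / 4) {A : Set H}
    (hA : ∀ σ : ι → κ, spikes e η σ ∈ A) :
    ENNReal.ofReal (Fintype.card ι * (η ^ 2 / 8)) ≤ minimaxRisk W P ε A := by
  classical
  refine le_iInf₂ fun T hT => ?_
  have hcard0 : (Fintype.card κ : ℝ≥0∞) ≠ 0 := by
    intro h0
    have : Fintype.card κ = 0 := by exact_mod_cast h0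
    rw [this] at hcard
    have := Real.exp_pos ((η / ε) ^ 2)
    norm_num at hcard
    linarith
  have hκ : Nonempty κ := Fintype.card_pos_iff.1 (Nat.pos_of_ne_zero (by exact_mod_cast hcard0))
  let τ : ι → (H → ℝ) → κ → ℝ := fun i y k => inner ℝ (e (i, k)) (T y)
  have hτ : ∀ i, Measurable (τ i) := fun i => measurable_pi_lambda _ fun k =>
    ((innerSL ℝ (e (i, k))).continuous.measurable).comp hT
  let G : ι → (ι → κ) → ℝ≥0∞ := fun i σ =>
    ∫⁻ ω, ENNReal.ofReal (spikeLoss η (σ i) (τ i (observation W ε (spikes e η σ) ω))) ∂P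
  have hobs : ∀ f, Measurable (observation W ε f) := fun f => measurable_pi_lambda _ fun h => by
    have := hW.measurable h
    unfold observation
    fun_prop
  have hrisk : ∀ σ, ∑ i, G i σ ≤ quadRisk W P ε T (spikes e η σ) := fun σ => by
    have hGm : ∀ i, Measurable fun ω => ENNReal.ofReal
        (spikeLoss η (σ i) (τ i (observation W ε (spikes e η σ) ω))) := fun i =>
      ((measurable_spikeLoss η (σ i)).comp ((hτ i).comp (hobs _))).ennreal_ofReal
    simp only [G]
    rw [← lintegral_finsetSum _ fun i _ => hGm i]
    refine lintegral_mono fun ω => ?_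
    rw [← ENNReal.ofReal_sum_of_nonneg fun i _ => spikeLoss_nonneg _ _ _, ← ofReal_norm,
      ← ENNReal.ofReal_pow (norm_nonneg _)]
    exact ENNReal.ofReal_le_ofReal (sum_spikeLoss_le he η σ _)
  -- Fixing the spikes outside block `i` makes them a known offset, and the one-spike bound applies.
  -- Resampling `σ i` then averages over all `σ`.
  have hblock : ∀ i, Fintype.card (ι → κ) * ENNReal.ofReal (η ^ 2 / 8) ≤ ∑ σ, G i σ := fun i => by
    have h1 : ∀ σ : ι → κ, Fintype.card κ * ENNReal.ofReal (η ^ 2 / 8) ≤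
        ∑ b, G i (Function.update σ i b) := fun σ => by
      have := hW.le_sum_lintegral_spikeLoss (e := fun b => e (i, b)) (fun b => he.1 _) (hτ i)
        (∑ j ∈ Finset.univ.erase i, η • e (j, σ j)) hε hη hcard
      rw [ENNReal.ofReal_mul (by positivity), ENNReal.ofReal_natCast] at this
      simpa only [G, spikes_update, Function.update_self] using this
    have h2 := Finset.sum_le_sum fun (σ : ι → κ) (_ : σ ∈ Finset.univ) => h1 σ
    rw [sum_sum_update, Finset.sum_const, nsmul_eq_mul, Finset.card_univ, ← mul_assoc,
      mul_comm (Fintype.card (ι → κ) : ℝ≥0∞), mul_assoc] at h2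
    exact (ENNReal.mul_le_mul_iff_right hcard0 (ENNReal.natCast_ne_top _)).1 h2
  have hN : (Fintype.card (ι → κ) : ℝ≥0∞) ≠ 0 := by
    exact_mod_cast Fintype.card_ne_zero
  refine (ENNReal.mul_le_mul_iff_right hN (ENNReal.natCast_ne_top _)).1 ?_
  calc Fintype.card (ι → κ) * ENNReal.ofReal (Fintype.card ι * (η ^ 2 / 8))
      = ∑ _i : ι, Fintype.card (ι → κ) * ENNReal.ofReal (η ^ 2 / 8) := by
        rw [ENNReal.ofReal_mul (by positivity), ENNReal.ofReal_natCast, Finset.sum_const,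
          nsmul_eq_mul, Finset.card_univ]
        ring
    _ ≤ ∑ i, ∑ σ, G i σ := Finset.sum_le_sum fun i _ => hblock i
    _ = ∑ σ, ∑ i, G i σ := Finset.sum_comm
    _ ≤ ∑ _σ : ι → κ, ⨆ f ∈ A, quadRisk W P ε T f := Finset.sum_le_sum fun σ _ =>
        (hrisk σ).trans (le_iSup₂_of_le (spikes e η σ) (hA σ) le_rfl)
    _ = _ := by rw [Finset.sum_const, nsmul_eq_mul, Finset.card_univ]

end Blocks

/-! ### Spike vectors in the ball -/

section Balls

variable {H : Type*} [NormedAddCommGroup H] [InnerProductSpace ℝ H] {φ : ℕ → H}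

lemma truncNorm_sum_le (φ : ℕ → H) (p : ℕ) (θ : Fin p → ℝ) :
    truncNorm φ p (∑ j, θ j • φ j) ≤ ∑ j, |θ j| := by
  refine csInf_le ⟨0, ?_⟩ ⟨θ, rfl, rfl⟩
  rintro c ⟨θ, -, rfl⟩
  positivity

lemma l1rNorm_nonneg (φ : ℕ → H) (r : ℝ) (g : H) : 0 ≤ l1rNorm φ r g :=
  Real.sInf_nonneg fun _ hC => hC.1.le

lemma l1rNorm_le {r C : ℝ} {g : H} (h : IsL1rBound φ r g C) : l1rNorm φ r g ≤ C :=
  csInf_le ⟨0, fun _ hC => hC.1.le⟩ h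

lemma norm_sum_smul (hφ : Orthonormal ℝ φ) {η : ℝ} (hη : 0 ≤ η) (s : Finset ℕ) :
    ‖∑ j ∈ s, η • φ j‖ = √(s.card : ℝ) * η := by
  have h := hφ.inner_sum (fun _ => η) (fun _ => η) s
  rw [real_inner_self_eq_norm_sq] at h
  simp only [conj_trivial, Finset.sum_const, nsmul_eq_mul] at h
  rw [← Real.sqrt_sq (norm_nonneg _), h, Real.sqrt_mul (Nat.cast_nonneg _),
    Real.sqrt_mul_self hη]

/-- A vector with coefficients of size `η` on `s ⊆ {0, …, p - 1}`, where `p ^ r ≤ √#s`. -/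
lemma isL1rBound_sum (hφ : Orthonormal ℝ φ) {r η : ℝ} (hr : 0 < r) (hη : 0 < η) {s : Finset ℕ}
    {p : ℕ} (hs : ∀ j ∈ s, j < p) (hne : s.Nonempty) (hp : (p : ℝ) ^ r ≤ √(s.card : ℝ)) :
    IsL1rBound φ r (∑ j ∈ s, η • φ j) (s.card * η) := by
  have hcard : 0 < (s.card : ℝ) := by exact_mod_cast hne.card_pos
  refine ⟨by positivity, fun k hk => ?_⟩
  have hk0 : (0 : ℝ) < k := by exact_mod_cast hk
  by_cases hpk : p ≤ k
  · let θ : Fin k → ℝ := fun j => if (j : ℕ) ∈ s then η else 0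
    have hsub : s ⊆ Finset.range k := fun j hj => Finset.mem_range.2 ((hs j hj).trans_le hpk)
    have hsum : ∑ j ∈ s, η • φ j = ∑ j : Fin k, θ j • φ j := by
      rw [Fin.sum_univ_eq_sum_range (fun j => (if j ∈ s then η else 0) • φ j) k]
      simp only [ite_smul, zero_smul]
      rw [Finset.sum_ite_mem, Finset.inter_eq_right.2 hsub]
    refine ⟨∑ j ∈ s, η • φ j, ?_, ?_, ?_⟩
    · rw [hsum]
      exact Submodule.sum_mem _ fun j _ => Submodule.smul_mem _ _ (Submodule.subset_span ⟨j, rfl⟩)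
    · rw [hsum]
      refine (truncNorm_sum_le φ k θ).trans (le_of_eq ?_)
      rw [Fin.sum_univ_eq_sum_range (fun j => |if j ∈ s then η else 0|) k]
      have : ∀ j, |if j ∈ s then η else 0| = if j ∈ s then η else 0 := fun j => by
        split_ifs <;> simp [hη.le]
      simp_rw [this]
      rw [Finset.sum_ite_mem, Finset.inter_eq_right.2 hsub]
      simp
    · rw [sub_self, norm_zero]
      positivity
  -- For `k < p` the approximant `0` suffices: the error is `√#s * η`, and `k ^ r ≤ p ^ r ≤ √#s`.
  · refine ⟨0, Submodule.zero_mem _, ?_, ?_⟩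
    · have := truncNorm_sum_le φ k 0
      simp only [Pi.zero_apply, zero_smul, Finset.sum_const_zero, abs_zero] at this
      exact this.trans (by positivity)
    · rw [sub_zero, norm_sum_smul hφ hη.le, Real.rpow_neg hk0.le]
      have hkr : (k : ℝ) ^ r ≤ √(s.card : ℝ) :=
        (Real.rpow_le_rpow hk0.le (by exact_mod_cast (not_le.1 hpk).le) hr.le).trans hp
      have hkr0 : 0 < (k : ℝ) ^ r := by positivity
      rw [← div_eq_mul_inv, le_div_iff₀ hkr0]
      nlinarith [Real.mul_self_sqrt hcard.le, mul_le_mul_of_nonneg_left hkr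
        (mul_nonneg (Real.sqrt_nonneg (s.card : ℝ)) hη.le)]

lemma isL1rBound_zero (φ : ℕ → H) (r : ℝ) {C : ℝ} (hC : 0 < C) : IsL1rBound φ r 0 C := by
  refine ⟨hC, fun p _ => ⟨0, Submodule.zero_mem _, ?_, ?_⟩⟩
  · have := truncNorm_sum_le φ p 0
    simp only [Pi.zero_apply, zero_smul, Finset.sum_const_zero, abs_zero] at this
    exact this.trans hC.le
  · rw [sub_zero, norm_zero]
    positivity

lemma l1rNorm_zero (φ : ℕ → H) (r : ℝ) : l1rNorm φ r 0 = 0 :=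
  le_antisymm (le_of_forall_pos_le_add fun C hC => by
    simpa using l1rNorm_le (isL1rBound_zero φ r hC)) (l1rNorm_nonneg φ r 0)

lemma iInf_le_of_isL1rBound {r δ C : ℝ} (hδ : 0 ≤ δ) (g : H) {h : H} (hh : IsL1rBound φ r h C) :
    ⨅ h : L1r φ r, (‖g - (h : H)‖ + δ * l1rNorm φ r (h : H)) ≤ ‖g - h‖ + δ * l1rNorm φ r h :=
  ciInf_le (f := fun h : L1r φ r => ‖g - (h : H)‖ + δ * l1rNorm φ r (h : H))
    ⟨0, by
      rintro _ ⟨k, rfl⟩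
      exact add_nonneg (norm_nonneg _) (mul_nonneg hδ (l1rNorm_nonneg _ _ _))⟩ ⟨h, C, hh⟩

/-- With `y = √#s`, comparing with `0` costs `y η` and comparing with the vector itself costs at
most `δ y² η`. The smaller is `y η * min 1 (y δ) ≤ y η (y δ) ^ α`, and `y ^ (1 + α) = #s ^ (1/q)`.
-/
theorem sum_smul_mem_bqr (hφ : Orthonormal ℝ φ) {q r R η : ℝ} (hq1 : 1 < q) (hr : 0 < r)
    (hη : 0 < η) {s : Finset ℕ} {p : ℕ} (hs : ∀ j ∈ s, j < p) (hne : s.Nonempty)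
    (hp : (p : ℝ) ^ r ≤ √(s.card : ℝ)) (hR : (s.card : ℝ) ^ (1 / q) * η ≤ R) (hq2 : q < 2) :
    ∑ j ∈ s, η • φ j ∈ bqr φ q r R := by
  intro δ hδ
  set α : ℝ := 2 * (1 / q - 1 / 2) with hα
  have hα0 : 0 ≤ α := by
    have : 1 / 2 ≤ 1 / q := one_div_le_one_div_of_le (by linarith) hq2.le
    linarith
  have hα1 : 0 ≤ 1 - α := by
    have : 1 / q ≤ 1 := by rw [div_le_one (by linarith)]; exact hq1.le
    linarith
  have hcard : 0 < (s.card : ℝ) := by exact_mod_cast hne.card_pos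
  set y : ℝ := √(s.card : ℝ) with hy
  have hy0 : 0 < y := Real.sqrt_pos.2 hcard
  have hyy : (s.card : ℝ) = y * y := (Real.mul_self_sqrt hcard.le).symm
  have hpow : (s.card : ℝ) ^ (1 / q) = y * y ^ α := by
    rw [hyy, Real.mul_rpow hy0.le hy0.le, ← Real.rpow_add hy0]
    nth_rewrite 2 [← Real.rpow_one y]
    rw [← Real.rpow_add hy0]
    congr 1
    rw [hα]
    ring
  rw [hpow] at hR
  have hδα : 0 < δ ^ α := by positivity
  have hmul : (y * δ) ^ α = y ^ α * δ ^ α := Real.mul_rpow hy0.le hδ.le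
  refine le_trans ?_ (mul_le_mul_of_nonneg_right hR hδα.le)
  by_cases hc : 1 ≤ y * δ
  · refine (iInf_le_of_isL1rBound hδ.le _ (isL1rBound_zero φ r one_pos)).trans ?_
    rw [l1rNorm_zero, sub_zero, mul_zero, add_zero, norm_sum_smul hφ hη.le, ← hy]
    have := Real.one_le_rpow hc hα0
    rw [hmul] at this
    nlinarith [mul_pos hy0 hη]
  · have hb := isL1rBound_sum hφ hr hη hs hne hp
    refine (iInf_le_of_isL1rBound hδ.le _ hb).trans ?_
    rw [sub_self, norm_zero, zero_add]
    refine (mul_le_mul_of_nonneg_left (l1rNorm_le hb) hδ.le).trans ?_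
    have hlt : 0 < y * δ := mul_pos hy0 hδ
    have h1 : y * δ ≤ (y * δ) ^ α := by
      have := Real.rpow_le_rpow_of_exponent_ge hlt (not_le.1 hc).le (show α ≤ 1 by linarith)
      rwa [Real.rpow_one] at this
    rw [hmul] at h1
    rw [hyy]
    nlinarith [mul_le_mul_of_nonneg_left h1 (mul_pos hy0 hη).le]

/-- Vectors with one spike in each of `m` consecutive blocks of length `B`. -/
lemma spikes_mem_bqr (hφ : Orthonormal ℝ φ) {q r R η : ℝ} (hq1 : 1 < q) (hq2 : q < 2) (hr : 0 < r)
    (hη : 0 < η) {m B : ℕ} (hm : 0 < m) (hp : ((m * B : ℕ) : ℝ) ^ r ≤ √(m : ℝ))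
    (hR : (m : ℝ) ^ (1 / q) * η ≤ R) (σ : Fin m → Fin B) :
    spikes (fun x : Fin m × Fin B => φ (finProdFinEquiv x)) η σ ∈ bqr φ q r R := by
  have hinj : Function.Injective fun i : Fin m => ((finProdFinEquiv (i, σ i) : Fin (m * B)) : ℕ) :=
    fun i j hij => (Prod.mk.inj (finProdFinEquiv.injective (Fin.val_injective hij))).1
  set s : Finset ℕ := Finset.univ.image fun i : Fin m => ((finProdFinEquiv (i, σ i) : Fin (m * B)) : ℕ)
    with hs
  have hcard : s.card = m := by rw [hs, Finset.card_image_of_injective _ hinj, Finset.card_univ, Fintype.card_fin]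
  have hsum : spikes (fun x : Fin m × Fin B => φ (finProdFinEquiv x)) η σ = ∑ j ∈ s, η • φ j := by
    rw [hs, Finset.sum_image hinj.injOn, spikes]
  rw [hsum]
  refine sum_smul_mem_bqr hφ hq1 hr hη (p := m * B) ?_ ?_ (by rwa [hcard]) (by rwa [hcard]) hq2
  · intro j hj
    obtain ⟨i, -, rfl⟩ := Finset.mem_image.1 hj
    exact Fin.is_lt _
  · rw [← Finset.card_pos, hcard]
    exact hm

end Balls

/-! ### Calibration and conclusion -/

/-- The number of blocks `m` and the block length `B` of the least favourable prior. -/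
lemma exists_block_sizes {q r κ ε R η : ℝ} (hq1 : 1 < q) (hr : 0 < r) (hr2 : 2 * r < 1)
    (hκ0 : 0 < κ) (hκ1 : κ ≤ 1 / 2) (hκ2 : κ ^ 2 ≤ (1 / (2 * r) - 1) / 2)
    (hκ3 : (2 * κ) ^ (1 / (2 * r) - 1) ≤ 1 / 8) (hε : 0 < ε) (hR : 0 < R)
    (hX : Real.exp 1 ^ 2 ≤ R * ε⁻¹) (hη : η = κ * (ε * √(Real.log (R * ε⁻¹)))) :
    ∃ m B : ℕ, 0 < m ∧ ((m * B : ℕ) : ℝ) ^ r ≤ √(m : ℝ) ∧ (m : ℝ) ^ (1 / q) * η ≤ R ∧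
      Real.exp ((η / ε) ^ 2) ≤ (B : ℝ) / 4 ∧ (R / η) ^ q / 2 ≤ m := by
  set X : ℝ := R * ε⁻¹ with hXdef
  -- This exponent solves `(m * m ^ s) ^ r = √m`, so `B = ⌊m ^ s⌋₊` respects the smoothness
  -- constraint.
  set s : ℝ := 1 / (2 * r) - 1 with hs
  have hs0 : 0 < s := by
    have : 1 < 1 / (2 * r) := by rw [lt_div_iff₀ (by linarith)]; linarith
    linarith
  have hX1 : 1 < X := by
    have := Real.add_one_le_exp (1 : ℝ)
    nlinarith
  have hX0 : 0 < X := by linarith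
  have hlog0 : 0 < Real.log X := Real.log_pos hX1
  have hη0 : 0 < η := by rw [hη]; positivity
  have hsq1 : 1 ≤ √X := Real.one_le_sqrt.2 hX1.le
  have hdiv : √X / κ ≤ R / η := by
    have h1 : √(Real.log X) ≤ √X := Real.sqrt_le_sqrt ((Real.log_le_sub_one_of_pos hX0).trans (by linarith))
    have h2 : R = X * ε := by rw [hXdef]; field_simp
    rw [div_le_div_iff₀ hκ0 hη0, hη, h2]
    have h3 : √X * √(Real.log X) ≤ X := by
      nlinarith [Real.mul_self_sqrt hX0.le, Real.sqrt_nonneg X]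
    nlinarith [mul_le_mul_of_nonneg_left h3 (mul_pos hκ0 hε).le]
  have hdiv2 : 2 ≤ √X / κ := by rw [le_div_iff₀ hκ0]; linarith
  have hRη1 : 1 ≤ R / η := by linarith
  have hM : √X / κ ≤ (R / η) ^ q := hdiv.trans (Real.self_le_rpow_of_one_le hRη1 hq1.le)
  set M : ℝ := (R / η) ^ q with hMdef
  have hfloor : ∀ x : ℝ, 1 ≤ x → x / 2 ≤ (⌊x⌋₊ : ℝ) := fun x hx => by
    have h1 := Nat.lt_floor_add_one x
    have h2 : (1 : ℝ) ≤ (⌊x⌋₊ : ℝ) := by exact_mod_cast (Nat.one_le_floor_iff x).2 hx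
    linarith
  have hm1 : 1 ≤ ⌊M⌋₊ := (Nat.one_le_floor_iff M).2 (by linarith)
  have hmM := hfloor M (by linarith)
  set m : ℕ := ⌊M⌋₊ with hm
  have hm1' : (1 : ℝ) ≤ m := by exact_mod_cast hm1
  have hm0 : (0 : ℝ) < m := by linarith
  have hms : 1 ≤ (m : ℝ) ^ s := Real.one_le_rpow hm1' hs0.le
  refine ⟨m, ⌊(m : ℝ) ^ s⌋₊, hm1, ?_, ?_, ?_, hmM⟩
  · have hB : (⌊(m : ℝ) ^ s⌋₊ : ℝ) ≤ (m : ℝ) ^ s := Nat.floor_le (by linarith)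
    rw [Nat.cast_mul, Real.sqrt_eq_rpow]
    calc ((m : ℝ) * ⌊(m : ℝ) ^ s⌋₊) ^ r ≤ ((m : ℝ) * (m : ℝ) ^ s) ^ r := by gcongr
      _ = (m : ℝ) ^ (1 / 2 : ℝ) := by
        nth_rewrite 1 [← Real.rpow_one (m : ℝ)]
        rw [← Real.rpow_add hm0, ← Real.rpow_mul hm0.le]
        congr 1
        rw [hs]
        field_simp
        ring
  · have h1 : (m : ℝ) ≤ M := Nat.floor_le (by linarith)
    have h2 : (m : ℝ) ^ (1 / q) ≤ R / η := by
      calc (m : ℝ) ^ (1 / q) ≤ M ^ (1 / q) := by gcongr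
        _ = R / η := by
          rw [hMdef, ← Real.rpow_mul (by positivity), mul_one_div_cancel (by linarith),
            Real.rpow_one]
    rwa [le_div_iff₀ hη0] at h2
  · have h1 : (η / ε) ^ 2 = κ ^ 2 * Real.log X := by
      have : η / ε = κ * √(Real.log X) := by rw [hη]; field_simp
      rw [this, mul_pow, Real.sq_sqrt hlog0.le]
    -- Here `κ² ≤ s / 2` is used. The factor `8` in `h4`, from `hκ3`, pays for the `4` in the goal
    -- and the `2` lost to the floor.
    have h2 : Real.exp ((η / ε) ^ 2) ≤ √X ^ s := by
      rw [h1, Real.sqrt_eq_rpow, ← Real.rpow_mul hX0.le, Real.rpow_def_of_pos hX0]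
      refine Real.exp_le_exp.2 ?_
      nlinarith
    have h3 : √X / (2 * κ) ≤ m := by
      have : √X / (2 * κ) = √X / κ / 2 := by field_simp
      rw [this]
      linarith
    have h4 : √X ^ s * 8 ≤ (m : ℝ) ^ s := by
      refine le_trans ?_ (Real.rpow_le_rpow (by positivity) h3 hs0.le)
      rw [Real.div_rpow (by positivity) (by positivity), le_div_iff₀ (by positivity)]
      have : 0 < √X ^ s := by positivity
      nlinarith
    have h5 := hfloor _ hms
    linarith

theorem proposition5p12 (q r u : ℝ) (hq1 : 1 < q) (hq2 : q < 2) (hr : 0 < r)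
    (hrq : r < 1 / q - 1 / 2) (hu : u = 1 / r - q * (1 + 1 / (2 * r))) :
    0 < u ∧ ∃ C : ℝ, 0 < C ∧
      ∀ (H : Type*) [NormedAddCommGroup H] [InnerProductSpace ℝ H] [CompleteSpace H]
        [MeasurableSpace H] [BorelSpace H] (φ : HilbertBasis ℕ ℝ H)
        (Ω : Type*) [MeasurableSpace Ω] (P : Measure Ω) [IsProbabilityMeasure P]
        (W : H → Ω → ℝ) (_ : IsIsonormal W P) (ε R : ℝ) (_ : 0 < ε) (_ : 0 < R)
        (_ : max (Real.exp 1 ^ 2) (u ^ 2) ≤ R * ε⁻¹),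
        ENNReal.ofReal (C * R ^ q * (ε * √(Real.log (R * ε⁻¹))) ^ (2 - q)) ≤
          minimaxRisk W P ε (bqr φ q r R) := by
  have hq0 : 0 < q := by linarith
  constructor
  · have h1 : u = q / r * (1 / q - 1 / 2 - r) := by
      rw [hu]
      field_simp
      ring
    rw [h1]
    exact mul_pos (by positivity) (by linarith)
  have hr2 : 2 * r < 1 := by
    have : 1 / q ≤ 1 := by rw [div_le_one hq0]; exact hq1.le
    linarith
  set s : ℝ := 1 / (2 * r) - 1 with hs
  have hs0 : 0 < s := by
    have : 1 < 1 / (2 * r) := by rw [lt_div_iff₀ (by linarith)]; linarith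
    linarith
  obtain ⟨κ, hκ0, hκ1, hκ2, hκ3⟩ : ∃ κ : ℝ, 0 < κ ∧ κ ≤ 1 / 2 ∧ κ ^ 2 ≤ s / 2 ∧
      (2 * κ) ^ s ≤ 1 / 8 := by
    refine ⟨min (1 / 2) (min √(s / 2) ((1 / 8) ^ (1 / s) / 2)), by positivity,
      min_le_left _ _, ?_, ?_⟩
    · rw [← Real.le_sqrt (by positivity) (by positivity)]
      exact (min_le_right _ _).trans (min_le_left _ _)
    · set κ := min (1 / 2) (min √(s / 2) ((1 / 8 : ℝ) ^ (1 / s) / 2)) with hκ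
      have h1 : 0 < κ := by positivity
      have h2 : 2 * κ ≤ (1 / 8 : ℝ) ^ (1 / s) := by
        have := (min_le_right (1 / 2 : ℝ) _).trans
          (min_le_right √(s / 2) ((1 / 8 : ℝ) ^ (1 / s) / 2))
        linarith
      calc (2 * κ) ^ s ≤ ((1 / 8 : ℝ) ^ (1 / s)) ^ s := by gcongr
        _ = 1 / 8 := by
          rw [← Real.rpow_mul (by norm_num), one_div_mul_cancel hs0.ne', Real.rpow_one]
  -- The `16` combines the `8` of the Bayes bound with the `2` lost in rounding `m` down.
  refine ⟨κ ^ (2 - q) / 16, by positivity, ?_⟩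
  intro H _ _ _ _ _ φ Ω _ P _ W hW ε R hε hR hX
  have hX' := (le_max_left _ _).trans hX
  set ρ : ℝ := ε * √(Real.log (R * ε⁻¹)) with hρ
  have hρ0 : 0 < ρ := by
    have : 1 < R * ε⁻¹ := by
      have := Real.add_one_le_exp (1 : ℝ)
      nlinarith
    have := Real.log_pos this
    positivity
  obtain ⟨m, B, hm, hp, hmR, hB, hmM⟩ :=
    exists_block_sizes hq1 hr hr2 hκ0 hκ1 hκ2 hκ3 hε hR hX' (η := κ * ρ) rfl
  have hη0 : 0 < κ * ρ := by positivity
  have hφ := φ.orthonormal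
  have he : Orthonormal ℝ fun x : Fin m × Fin B => φ (finProdFinEquiv x : Fin (m * B)) :=
    hφ.comp (fun x : Fin m × Fin B => ((finProdFinEquiv x : Fin (m * B)) : ℕ))
      (Fin.val_injective.comp finProdFinEquiv.injective)
  refine le_trans (ENNReal.ofReal_le_ofReal ?_)
    (hW.le_minimaxRisk_of_spikes he hε hη0 (by simpa using hB)
      (spikes_mem_bqr hφ hq1 hq2 hr hη0 hm hp hmR))
  rw [Fintype.card_fin]
  have h1 : κ ^ (2 - q) / 16 * R ^ q * ρ ^ (2 - q) =
      (R / (κ * ρ)) ^ q / 2 * ((κ * ρ) ^ 2 / 8) := by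
    have h2 : κ ^ (2 - q) * ρ ^ (2 - q) = (κ * ρ) ^ 2 / (κ * ρ) ^ q := by
      rw [← Real.mul_rpow hκ0.le hρ0.le, Real.rpow_sub hη0, Real.rpow_two]
    rw [Real.div_rpow hR.le hη0.le]
    calc _ = R ^ q / 16 * (κ ^ (2 - q) * ρ ^ (2 - q)) := by ring
      _ = _ := by rw [h2]; ring
  rw [h1]
  gcongr
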